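/- Rings are associative with unit, not necessarily commutative. For a ring $R$, let $V(R)$ be the commutative monoid of isomorphism classes of finitely generated projective right $R$-modules with $[A]+[B]=[A\oplus B]$, and let $J(R)$ be the Jacobson radical of $R$. The ring $R$ is called a refinement ring if $V(R)$ has the refinement property: whenever $n,m\ge 2$ and $x_1+\dots+x_n=y_1+\dots+y_m$ in $V(R)$, there are $z_{ij}\in V(R)$ with $x_i=\sum_j z_{ij}$ for all $i$ and $y_j=\sum_i z_{ij}$ for all $j$. An $m\times n$ matrix $A$ over a ring is called regular if $ABA=A$ for some $n\times m$ matrix $B$ over that ring. It admits a diagonal reduction if there are invertible matrices $P$ ($m\times m$) and $Q$ ($n\times n$) over that ring such that all $(i,j)$ entries of $PAQ$ with $i\ne j$ are zero. Proposition. Let $R$ be a refinement ring such that every regular matrix over $R/J(R)$ (of any size $m\times n$) admits a diagonal reduction. Then every regular matrix over $R$ (of any size $m\times n$) admits a diagonal reduction. -/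

import Mathlib

universe u

/-- A finitely generated projective right module over `R` (right `R`-modules are modules over
`Rᵐᵒᵖ`). Every finitely generated projective right `R`-module is a direct summand of some `R ^ n`,
so carriers in the universe of `R` represent all isomorphism classes. -/
structure FGProjModule (R : Type u) [Ring R] where
  carrier : Type u
  [addCommGroup : AddCommGroup carrier]
  [module : Module Rᵐᵒᵖ carrier]
  [finite : Module.Finite Rᵐᵒᵖ carrier]
  [projective : Module.Projective Rᵐᵒᵖ carrier]

namespace FGProjModule

attribute [instance] addCommGroup module finite projective

variable {R : Type u} [Ring R]

/-- Two finitely generated projective modules are identified if they are isomorphic. -/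
instance setoid (R : Type u) [Ring R] : Setoid (FGProjModule R) where
  r M N := Nonempty (M.carrier ≃ₗ[Rᵐᵒᵖ] N.carrier)
  iseqv :=
    { refl := fun _ => ⟨LinearEquiv.refl _ _⟩
      symm := fun ⟨e⟩ => ⟨e.symm⟩
      trans := fun ⟨e⟩ ⟨f⟩ => ⟨e.trans f⟩ }

/-- The direct sum of two finitely generated projective modules. -/
def directSum (M N : FGProjModule R) : FGProjModule R where
  carrier := M.carrier × N.carrier

/-- The zero module. -/
def zeroModule (R : Type u) [Ring R] : FGProjModule R where
  carrier := PUnit.{u + 1}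

end FGProjModule

/-- The underlying set of `V(R)`: isomorphism classes of finitely generated projective right
`R`-modules. -/
def ProjMonoid (R : Type u) [Ring R] : Type (u + 1) :=
  Quotient (FGProjModule.setoid R)

namespace ProjMonoid

variable {R : Type u} [Ring R]

/-- The isomorphism class of a finitely generated projective module. -/
def mk (M : FGProjModule R) : ProjMonoid R :=
  Quotient.mk (FGProjModule.setoid R) M

/-- The addition of `V(R)`, induced by the direct sum: `[M] + [N] = [M ⊕ N]`. -/
instance instAdd (R : Type u) [Ring R] : Add (ProjMonoid R) where
  add := Quotient.map₂ FGProjModule.directSum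
    (fun _ _ ⟨e⟩ _ _ ⟨f⟩ => ⟨LinearEquiv.prodCongr e f⟩)

/-- The zero of `V(R)`: the class of the zero module. -/
instance instZero (R : Type u) [Ring R] : Zero (ProjMonoid R) where
  zero := mk (FGProjModule.zeroModule R)

/-- `V(R)` is a commutative monoid under `[M] + [N] = [M ⊕ N]`. -/
instance addCommMonoid (R : Type u) [Ring R] : AddCommMonoid (ProjMonoid R) where
  add_assoc := by
    rintro ⟨M⟩ ⟨N⟩ ⟨P⟩
    exact Quotient.sound ⟨LinearEquiv.prodAssoc Rᵐᵒᵖ M.carrier N.carrier P.carrier⟩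
  zero_add := by
    rintro ⟨M⟩
    exact Quotient.sound ⟨(LinearEquiv.uniqueProd : (PUnit.{u + 1} × M.carrier) ≃ₗ[Rᵐᵒᵖ] M.carrier)⟩
  add_zero := by
    rintro ⟨M⟩
    exact Quotient.sound ⟨(LinearEquiv.prodUnique : (M.carrier × PUnit.{u + 1}) ≃ₗ[Rᵐᵒᵖ] M.carrier)⟩
  add_comm := by
    rintro ⟨M⟩ ⟨N⟩
    exact Quotient.sound ⟨LinearEquiv.prodComm Rᵐᵒᵖ M.carrier N.carrier⟩
  nsmul := nsmulRec

theorem mk_eq_mk_iff (M N : FGProjModule R) :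
    mk M = mk N ↔ Nonempty (M.carrier ≃ₗ[Rᵐᵒᵖ] N.carrier) :=
  Quotient.eq (r := FGProjModule.setoid R)

theorem mk_add_mk (M N : FGProjModule R) : mk M + mk N = mk (M.directSum N) :=
  rfl

end ProjMonoid

/-- The refinement property of a commutative monoid: any two finite sum decompositions (with at
least two terms each) of the same element have a common refinement. -/
def HasRefinementProperty (M : Type*) [AddCommMonoid M] : Prop :=
  ∀ n m : ℕ, 2 ≤ n → 2 ≤ m → ∀ (x : Fin n → M) (y : Fin m → M), ∑ i, x i = ∑ j, y j →
    ∃ z : Fin n → Fin m → M, (∀ i, x i = ∑ j, z i j) ∧ (∀ j, y j = ∑ i, z i j)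

/-- `R` is a refinement ring if `V(R)` has the refinement property. -/
def IsRefinementRing (R : Type u) [Ring R] : Prop :=
  HasRefinementProperty (ProjMonoid R)

namespace Matrix

variable {R : Type*} [Ring R] {m n : ℕ}

/-- A (von Neumann) regular matrix: `A * B * A = A` for some matrix `B`. -/
def IsRegularMatrix (A : Matrix (Fin m) (Fin n) R) : Prop :=
  ∃ B : Matrix (Fin n) (Fin m) R, A * B * A = A

/-- A possibly rectangular diagonal matrix. -/
def IsDiagonalMatrix (A : Matrix (Fin m) (Fin n) R) : Prop :=
  ∀ (i : Fin m) (j : Fin n), (i : ℕ) ≠ (j : ℕ) → A i j = 0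

/-- `A` admits a diagonal reduction if `P * A * Q` is diagonal for some invertible `P`, `Q`. -/
def AdmitsDiagonalReduction (A : Matrix (Fin m) (Fin n) R) : Prop :=
  ∃ (P : Matrix (Fin m) (Fin m) R) (Q : Matrix (Fin n) (Fin n) R),
    IsUnit P ∧ IsUnit Q ∧ IsDiagonalMatrix (P * A * Q)

end Matrix

/-- Every regular matrix over `R`, of any size, admits a diagonal reduction. -/
def RegularMatricesDiagonalizable (R : Type*) [Ring R] : Prop :=
  ∀ (m n : ℕ) (A : Matrix (Fin m) (Fin n) R), A.IsRegularMatrix → A.AdmitsDiagonalReduction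

/-! A regular `m × n` matrix acting on columns is a split map of free right modules. Let `k`, `x`,
`l` be the classes of its kernel, image and cokernel, and `e = [R]`. Then `x + k = n • e` and `x + l
= m • e`, and the triple determines the matrix up to equivalence. So a diagonal reduction exists as
soon as the triple is a sum of triples with `x₀ + k₀ = e = x₀ + l₀`, one per diagonal entry, plus
free summands for surplus rows or columns. This is a question about the monoid `V(R)`.

`HasRefinementProperty.diagonalType` answers it using refinement and one cancellation law: `c + b =
e` and `c + a = e + e` imply `a = e + b`.

The law (`ProjMonoid.cancel_of_quotient_jacobson`) comes from the quotient by the radical. It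
amounts to diagonalizing a regular `1 × 2` row. A reduction modulo `J(R)` lifts to invertible
matrices over `R`, leaving off-diagonal entries in `J(R)`, and regularity of the row lets an
invertible column operation clear these. -/

/-! ### Diagonal decompositions in a refinement monoid. -/

/-- `DiagonalType e n m k x l` says that `(k, x, l)` is a sum of classes of kernels, images and
cokernels of the diagonal entries of an `m × n` diagonal matrix, `e` being the class of the ring. -/
inductive DiagonalType {M : Type*} [AddCommMonoid M] (e : M) : ℕ → ℕ → M → M → M → Prop
  | noRows (n : ℕ) : DiagonalType e n 0 (n • e) 0 0
  | noCols (m : ℕ) : DiagonalType e 0 m 0 0 (m • e)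
  | cons {n m : ℕ} {k₀ x₀ l₀ k x l : M} (hk : x₀ + k₀ = e) (hl : x₀ + l₀ = e)
      (h : DiagonalType e n m k x l) :
      DiagonalType e (n + 1) (m + 1) (k₀ + k) (x₀ + x) (l₀ + l)

namespace HasRefinementProperty

variable {M : Type*} [AddCommMonoid M]

theorem exists_refinement (hM : HasRefinementProperty M) {a b c d : M} (h : a + b = c + d) :
    ∃ p q r s : M, a = p + q ∧ b = r + s ∧ c = p + r ∧ d = q + s := by
  obtain ⟨z, h₁, h₂⟩ := hM 2 2 le_rfl le_rfl ![a, b] ![c, d] (by simpa using h)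
  refine ⟨z 0 0, z 0 1, z 1 0, z 1 1, ?_, ?_, ?_, ?_⟩
  · simpa using h₁ 0
  · simpa using h₁ 1
  · simpa using h₂ 0
  · simpa using h₂ 1

variable {e : M} (hM : HasRefinementProperty M)
  (hE : ∀ a b c : M, c + b = e → c + a = e + e → a = e + b)

include hM hE

/-- Refining the equation writes the left `e` as `s + p` with `s` a summand of `e + e` and `p` a
summand of `b`, which is exactly the situation of `hE`. -/
theorem cancel_of_two {a b : M} (h : e + a = e + e + b) : a = e + b := by
  obtain ⟨s, p, t, q, he, ha, hst, hb⟩ := hM.exists_refinement h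
  have ht : t = e + p := hE t p s he.symm hst.symm
  rw [ha, ht, hb, add_assoc]

theorem cancel {j : ℕ} {a b : M} (h : e + a = (j + 2) • e + b) : a = (j + 1) • e + b := by
  have := hM.cancel_of_two hE (a := a) (b := j • e + b) (by
    rw [h, add_smul, two_smul]; abel)
  rw [this, add_smul, one_smul]; abel

/-- Copies of `e` cancel one at a time, as long as a copy remains on the right. -/
theorem cancel_nsmul (i : ℕ) {j : ℕ} {a b : M} (h : i • e + a = (i + j + 1) • e + b) :
    a = (j + 1) • e + b := by
  induction i with
  | zero => simpa using h
  | succ i ih =>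
    refine ih (hM.cancel hE (j := i + j) ?_)
    rw [← add_assoc, ← succ_nsmul', h]
    congr 2
    ring

omit hE in
-- When kernel and cokernel agree up to free summands, refining `x + l = e + ⋯ + e` already yields
-- the diagonal entries, each with `k₀ = l₀`. The `j` surplus columns contribute `j • e` to the
-- kernel.
theorem diagonalType_extraCols (j : ℕ) {m : ℕ} {x l : M} (h : x + l = (m + 1) • e) :
    DiagonalType e (j + m + 1) (m + 1) (l + j • e) x l := by
  induction m generalizing x l with
  | zero =>
    have h' : x + l = e := by simpa using h
    simpa using DiagonalType.cons h' h' (DiagonalType.noRows (e := e) j)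
  | succ m ih =>
    obtain ⟨x₀, x', l₀, l', rfl, rfl, h₀, h'⟩ :=
      hM.exists_refinement (h.trans (succ_nsmul' e (m + 1)))
    simpa [add_assoc] using DiagonalType.cons h₀.symm h₀.symm (ih h'.symm)

/-- Cancellation gives only `k + e = l + e`, so `k` and `l` may differ. The whole difference is put
into one diagonal entry, and the others have equal kernel and cokernel. -/
theorem diagonalType_square {m : ℕ} {k x l : M} (hk : x + k = (m + 1) • e)
    (hl : x + l = (m + 1) • e) : DiagonalType e (m + 1) (m + 1) k x l := by
  obtain _ | m := m
  · have hk' : x + k = e := by simpa using hk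
    have hl' : x + l = e := by simpa using hl
    simpa using DiagonalType.cons hk' hl' (DiagonalType.noRows (e := e) 0)
  have hkl : k + e = l + e := by
    have := hM.cancel_nsmul hE (m + 1) (j := 0) (a := e + k) (b := l) (by
      rw [← add_assoc, ← succ_nsmul, ← hl, add_right_comm, hk, ← hl])
    rw [add_comm, this, add_comm]; simp
  obtain ⟨d, k', l', c, rfl, he, rfl, he'⟩ := hM.exists_refinement hkl
  have hxd : x + d = (m + 1) • e + c := by
    refine hM.cancel hE ?_
    rw [← hk, add_assoc, add_assoc, ← he']
    abel
  -- The common part `d` of `k` and `l` splits as `d' + c'`. The exceptional entry is `(c' + k', x₀,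
  -- c' + l')`, and `x' + d' = (m + 1) • e` leaves `(d', x', d')` for the rest.
  obtain ⟨x', x₀, d', c', rfl, rfl, h', rfl⟩ := hM.exists_refinement hxd
  have hk₀ : x₀ + (c' + k') = e := by rw [he']; abel
  have hl₀ : x₀ + (c' + l') = e := by rw [he]; abel
  convert DiagonalType.cons hk₀ hl₀
    (hM.diagonalType_extraCols 0 (x := x') (l := d') h'.symm) using 1
  · simp
  · simp; abel
  · abel
  · abel

theorem diagonalType_of_le {m j : ℕ} {k x l : M} (hk : x + k = (j + m + 1) • e)
    (hl : x + l = (m + 1) • e) : DiagonalType e (j + m + 1) (m + 1) k x l := by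
  obtain _ | j := j
  · simp only [zero_add] at hk ⊢
    exact hM.diagonalType_square hE hk hl
  -- A surplus column keeps a copy of `e` on the right, so here cancellation determines `k`
  -- completely.
  have h : k = (j + 1) • e + l := hM.cancel_nsmul hE (m + 1) (by
    rw [← hl, add_right_comm, hk]
    congr 2
    ring)
  rw [h, add_comm (_ • e)]
  exact hM.diagonalType_extraCols (j + 1) hl

end HasRefinementProperty

theorem DiagonalType.symm {M : Type*} [AddCommMonoid M] {e : M} {n m : ℕ} {k x l : M}
    (h : DiagonalType e n m k x l) : DiagonalType e m n l x k := by
  induction h with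
  | noRows n => exact .noCols n
  | noCols m => exact .noRows m
  | cons hk hl _ ih => exact .cons hl hk ih

theorem HasRefinementProperty.diagonalType {M : Type*} [AddCommMonoid M] {e : M}
    (hM : HasRefinementProperty M) (hE : ∀ a b c : M, c + b = e → c + a = e + e → a = e + b)
    {n m : ℕ} {k x l : M} (hk : x + k = (n + 1) • e) (hl : x + l = (m + 1) • e) :
    DiagonalType e (n + 1) (m + 1) k x l := by
  obtain h | h := le_total m n
  · obtain ⟨j, rfl⟩ := Nat.exists_eq_add_of_le' h
    exact hM.diagonalType_of_le hE hk hl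
  · obtain ⟨j, rfl⟩ := Nat.exists_eq_add_of_le' h
    exact (hM.diagonalType_of_le hE hl hk).symm

/-! ### Split linear maps and their kernel, image and cokernel. -/

section SplitType

variable {S : Type*} [Ring S]

/-- A linear map is of split type `(K, X, L)` if it is isomorphic to the map
`K × X → X × L` sending `(k, x)` to `(x, 0)`. -/
def LinearMap.HasSplitType {M N : Type*} [AddCommGroup M] [Module S M] [AddCommGroup N]
    [Module S N] (f : M →ₗ[S] N) (K X L : Type*) [AddCommGroup K] [Module S K] [AddCommGroup X]
    [Module S X] [AddCommGroup L] [Module S L] : Prop :=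
  ∃ (e₁ : M ≃ₗ[S] K × X) (e₂ : N ≃ₗ[S] X × L), ∀ v, e₂ (f v) = ((e₁ v).2, 0)

namespace LinearMap.HasSplitType

variable {M N M' N' K X L K' X' L' : Type*} [AddCommGroup M] [Module S M]
  [AddCommGroup N] [Module S N] [AddCommGroup M'] [Module S M'] [AddCommGroup N'] [Module S N']
  [AddCommGroup K] [Module S K] [AddCommGroup X] [Module S X] [AddCommGroup L] [Module S L]
  [AddCommGroup K'] [Module S K'] [AddCommGroup X'] [Module S X'] [AddCommGroup L'] [Module S L']
  {f : M →ₗ[S] N} {f' : M' →ₗ[S] N'}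

theorem congr (h : f.HasSplitType K X L) (a : K ≃ₗ[S] K') (b : X ≃ₗ[S] X') (c : L ≃ₗ[S] L') :
    f.HasSplitType K' X' L' := by
  obtain ⟨e₁, e₂, he⟩ := h
  exact ⟨e₁.trans (a.prodCongr b), e₂.trans (b.prodCongr c), fun v => by simp [he]⟩

/-- Maps of the same split type are equivalent. -/
theorem exists_equiv (h : f.HasSplitType K X L) (h' : f'.HasSplitType K X L) :
    ∃ (α : M' ≃ₗ[S] M) (β : N ≃ₗ[S] N'), ∀ v, β (f (α v)) = f' v := by
  obtain ⟨e₁, e₂, he⟩ := h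
  obtain ⟨e₁', e₂', he'⟩ := h'
  refine ⟨e₁'.trans e₁.symm, e₂.trans e₂'.symm, fun v => ?_⟩
  simp [he, ← he']

theorem of_equiv (h : f.HasSplitType K X L) (α : M' ≃ₗ[S] M) (β : N ≃ₗ[S] N')
    (hf : ∀ v, β (f (α v)) = f' v) : f'.HasSplitType K X L := by
  obtain ⟨e₁, e₂, he⟩ := h
  exact ⟨α.trans e₁, β.symm.trans e₂, fun v => by simp [he, ← hf]⟩

theorem prodMap (h : f.HasSplitType K X L) (h' : f'.HasSplitType K' X' L') :
    (f.prodMap f').HasSplitType (K × K') (X × X') (L × L') := by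
  obtain ⟨e₁, e₂, he⟩ := h
  obtain ⟨e₁', e₂', he'⟩ := h'
  exact ⟨(e₁.prodCongr e₁').trans (LinearEquiv.prodProdProdComm ..),
    (e₂.prodCongr e₂').trans (LinearEquiv.prodProdProdComm ..), fun v => by simp [he, he']⟩

theorem kerEquiv (h : f.HasSplitType K X L) : Nonempty (LinearMap.ker f ≃ₗ[S] K) := by
  obtain ⟨e₁, e₂, he⟩ := h
  have hmem (v : M) : f v = 0 ↔ (e₁ v).2 = 0 := by
    rw [← e₂.map_eq_zero_iff, he]; simp
  refine ⟨LinearEquiv.ofBijective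
    (LinearMap.fst S K X ∘ₗ e₁.toLinearMap ∘ₗ (LinearMap.ker f).subtype) ⟨?_, fun k => ?_⟩⟩
  · rw [← LinearMap.ker_eq_bot, LinearMap.ker_eq_bot']
    rintro ⟨v, hv⟩ h₁
    ext
    exact e₁.map_eq_zero_iff.1 (Prod.ext h₁ ((hmem v).1 hv))
  · exact ⟨⟨e₁.symm (k, 0), (hmem _).2 (by simp)⟩, by simp⟩

theorem rangeEquiv (h : f.HasSplitType K X L) : Nonempty (LinearMap.range f ≃ₗ[S] X) := by
  obtain ⟨e₁, e₂, he⟩ := h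
  refine ⟨LinearEquiv.ofBijective
    (LinearMap.fst S X L ∘ₗ e₂.toLinearMap ∘ₗ (LinearMap.range f).subtype) ⟨?_, fun x => ?_⟩⟩
  · rw [← LinearMap.ker_eq_bot, LinearMap.ker_eq_bot']
    rintro ⟨_, v, rfl⟩ hv
    ext
    apply e₂.injective
    simpa [he] using hv
  · exact ⟨⟨f (e₁.symm (0, x)), _, rfl⟩, by simp [he]⟩

theorem exists_pseudoInverse (h : f.HasSplitType K X L) :
    ∃ g : N →ₗ[S] M, ∀ v, f (g (f v)) = f v := by
  obtain ⟨e₁, e₂, he⟩ := h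
  refine ⟨e₁.symm.toLinearMap ∘ₗ LinearMap.inr S K X ∘ₗ LinearMap.fst S X L ∘ₗ e₂.toLinearMap,
    fun v => e₂.injective ?_⟩
  simp [he]

end LinearMap.HasSplitType

/-- Both `g ∘ f` and `f ∘ g` are idempotent. The first splits the domain along `ker f`; the second
projects the codomain onto `range f`, so its kernel serves as the cokernel of `f`. -/
theorem LinearMap.hasSplitType_of_pseudoInverse {M N : Type*} [AddCommGroup M] [Module S M]
    [AddCommGroup N] [Module S N] (f : M →ₗ[S] N) (g : N →ₗ[S] M) (h : ∀ v, f (g (f v)) = f v) :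
    f.HasSplitType (LinearMap.ker f) (LinearMap.range f) (LinearMap.ker (f ∘ₗ g)) := by
  have hr (x : N) (hx : x ∈ LinearMap.range f) : f (g x) = x := by
    obtain ⟨v, rfl⟩ := hx; exact h v
  refine ⟨LinearEquiv.ofLinearMap
    (LinearMap.prod ((LinearMap.id - g ∘ₗ f).codRestrict _ fun v => by simp [h]) f.rangeRestrict)
    (LinearMap.coprod (LinearMap.ker f).subtype (g ∘ₗ (LinearMap.range f).subtype)) ?_ ?_,
    LinearEquiv.ofLinearMap
    (LinearMap.prod (f.rangeRestrict ∘ₗ g) ((LinearMap.id - f ∘ₗ g).codRestrict _ fun v => by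
      simp [h]))
    (LinearMap.coprod (LinearMap.range f).subtype (LinearMap.ker (f ∘ₗ g)).subtype) ?_ ?_, ?_⟩
  · ext ⟨v, hv⟩
    · simp [LinearMap.mem_ker.1 hv]
    · simp [LinearMap.mem_ker.1 hv]
    · simp [hr v hv]
    · simp [hr v hv]
  · ext v; simp
  · ext ⟨v, hv⟩
    · simp [hr v hv]
    · simp [hr v hv]
    · simpa using LinearMap.mem_ker.1 hv
    · simpa using LinearMap.mem_ker.1 hv
  · ext v; simp
  · intro v
    ext <;> simp [h]

end SplitType

/-! ### Free right modules and classes of maps in `V(R)`. -/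

section MulOpposite

variable (R : Type*) [Ring R]

/-- A ring is isomorphic to its opposite as a right module. -/
def MulOpposite.rightLinearEquiv : Rᵐᵒᵖ ≃ₗ[Rᵐᵒᵖ] R where
  toFun := MulOpposite.unop
  invFun := MulOpposite.op
  map_add' _ _ := rfl
  map_smul' _ _ := rfl

instance Module.Free.mulOpposite_self : Module.Free Rᵐᵒᵖ R :=
  .of_equiv (MulOpposite.rightLinearEquiv R)

instance Module.Finite.mulOpposite_self : Module.Finite Rᵐᵒᵖ R :=
  .equiv (MulOpposite.rightLinearEquiv R)

end MulOpposite

namespace FGProjModule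

variable (R : Type u) [Ring R]

/-- The free right module of rank one. -/
def self : FGProjModule R where
  carrier := R

/-- The free right module `R ^ n`. -/
def pi (n : ℕ) : FGProjModule R where
  carrier := Fin n → R

end FGProjModule

namespace ProjMonoid

variable {R : Type u} [Ring R]

theorem mk_pi (n : ℕ) : mk (FGProjModule.pi R n) = n • mk (FGProjModule.self R) := by
  induction n with
  | zero =>
    rw [zero_smul]
    refine (mk_eq_mk_iff _ _).2 ⟨?_⟩
    exact (LinearEquiv.ofSubsingleton (Fin 0 → R) PUnit.{u + 1} :
      (Fin 0 → R) ≃ₗ[Rᵐᵒᵖ] PUnit.{u + 1})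
  | succ n ih =>
    rw [succ_nsmul', ← ih, mk_add_mk]
    exact (mk_eq_mk_iff _ _).2 ⟨(Fin.consLinearEquiv Rᵐᵒᵖ fun _ : Fin (n + 1) => R).symm⟩

end ProjMonoid

/-- A linear map of right modules has class `(k, x, l)` if it is of a split type formed by finitely
generated projective modules of these classes. -/
def LinearMap.HasClass {R : Type u} [Ring R] {M N : Type*} [AddCommGroup M] [Module Rᵐᵒᵖ M]
    [AddCommGroup N] [Module Rᵐᵒᵖ N] (f : M →ₗ[Rᵐᵒᵖ] N) (k x l : ProjMonoid R) : Prop :=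
  ∃ K X L : FGProjModule R, ProjMonoid.mk K = k ∧ ProjMonoid.mk X = x ∧ ProjMonoid.mk L = l ∧
    f.HasSplitType K.carrier X.carrier L.carrier

namespace LinearMap.HasClass

variable {R : Type u} [Ring R] {M N M' N' : Type*} [AddCommGroup M] [Module Rᵐᵒᵖ M]
  [AddCommGroup N] [Module Rᵐᵒᵖ N] [AddCommGroup M'] [Module Rᵐᵒᵖ M'] [AddCommGroup N']
  [Module Rᵐᵒᵖ N'] {f : M →ₗ[Rᵐᵒᵖ] N} {f' : M' →ₗ[Rᵐᵒᵖ] N'} {k x l k' x' l' : ProjMonoid R}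

theorem exists_equiv (h : f.HasClass k x l) (h' : f'.HasClass k x l) :
    ∃ (α : M' ≃ₗ[Rᵐᵒᵖ] M) (β : N ≃ₗ[Rᵐᵒᵖ] N'), ∀ v, β (f (α v)) = f' v := by
  obtain ⟨K, X, L, rfl, rfl, rfl, hf⟩ := h
  obtain ⟨K', X', L', hK, hX, hL, hf'⟩ := h'
  obtain ⟨a⟩ := (ProjMonoid.mk_eq_mk_iff _ _).1 hK
  obtain ⟨b⟩ := (ProjMonoid.mk_eq_mk_iff _ _).1 hX
  obtain ⟨c⟩ := (ProjMonoid.mk_eq_mk_iff _ _).1 hL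
  exact hf.exists_equiv (hf'.congr a b c)

theorem of_equiv (h : f.HasClass k x l) (α : M' ≃ₗ[Rᵐᵒᵖ] M) (β : N ≃ₗ[Rᵐᵒᵖ] N')
    (hf : ∀ v, β (f (α v)) = f' v) : f'.HasClass k x l := by
  obtain ⟨K, X, L, hK, hX, hL, h⟩ := h
  exact ⟨K, X, L, hK, hX, hL, h.of_equiv α β hf⟩

theorem prodMap (h : f.HasClass k x l) (h' : f'.HasClass k' x' l') :
    (f.prodMap f').HasClass (k + k') (x + x') (l + l') := by
  obtain ⟨K, X, L, rfl, rfl, rfl, h⟩ := h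
  obtain ⟨K', X', L', rfl, rfl, rfl, h'⟩ := h'
  exact ⟨K.directSum K', X.directSum X', L.directSum L', rfl, rfl, rfl, h.prodMap h'⟩

theorem ker_unique (h : f.HasClass k x l) (h' : f.HasClass k' x' l') : k = k' := by
  obtain ⟨K, X, L, rfl, rfl, rfl, h⟩ := h
  obtain ⟨K', X', L', rfl, rfl, rfl, h'⟩ := h'
  obtain ⟨a⟩ := h.kerEquiv
  obtain ⟨b⟩ := h'.kerEquiv
  exact (ProjMonoid.mk_eq_mk_iff _ _).2 ⟨a.symm.trans b⟩

theorem range_unique (h : f.HasClass k x l) (h' : f.HasClass k' x' l') : x = x' := by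
  obtain ⟨K, X, L, rfl, rfl, rfl, h⟩ := h
  obtain ⟨K', X', L', rfl, rfl, rfl, h'⟩ := h'
  obtain ⟨a⟩ := h.rangeEquiv
  obtain ⟨b⟩ := h'.rangeEquiv
  exact (ProjMonoid.mk_eq_mk_iff _ _).2 ⟨a.symm.trans b⟩

theorem add_eq_domain {M N : FGProjModule R} {f : M.carrier →ₗ[Rᵐᵒᵖ] N.carrier}
    (h : f.HasClass k x l) : x + k = ProjMonoid.mk M := by
  obtain ⟨K, X, L, rfl, rfl, rfl, e₁, -, -⟩ := h
  rw [add_comm, ProjMonoid.mk_add_mk]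
  exact (ProjMonoid.mk_eq_mk_iff _ _).2 ⟨e₁.symm⟩

theorem add_eq_codomain {M N : FGProjModule R} {f : M.carrier →ₗ[Rᵐᵒᵖ] N.carrier}
    (h : f.HasClass k x l) : x + l = ProjMonoid.mk N := by
  obtain ⟨K, X, L, rfl, rfl, rfl, -, e₂, -⟩ := h
  rw [ProjMonoid.mk_add_mk]
  exact (ProjMonoid.mk_eq_mk_iff _ _).2 ⟨e₂.symm⟩

theorem exists_of_add_eq {M N : FGProjModule R} (hM : x + k = ProjMonoid.mk M) (hN : x + l = ProjMonoid.mk N) :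
    ∃ f : M.carrier →ₗ[Rᵐᵒᵖ] N.carrier, f.HasClass k x l := by
  obtain ⟨K, rfl⟩ : ∃ K, ProjMonoid.mk K = k := Quotient.exists_rep k
  obtain ⟨X, rfl⟩ : ∃ X, ProjMonoid.mk X = x := Quotient.exists_rep x
  obtain ⟨L, rfl⟩ : ∃ L, ProjMonoid.mk L = l := Quotient.exists_rep l
  rw [add_comm] at hM
  obtain ⟨e₁⟩ := (ProjMonoid.mk_eq_mk_iff _ _).1 hM
  obtain ⟨e₂⟩ := (ProjMonoid.mk_eq_mk_iff _ _).1 hN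
  let e₁' : (K.carrier × X.carrier) ≃ₗ[Rᵐᵒᵖ] M.carrier := e₁
  let e₂' : (X.carrier × L.carrier) ≃ₗ[Rᵐᵒᵖ] N.carrier := e₂
  exact ⟨e₂'.toLinearMap ∘ₗ LinearMap.inl _ _ _ ∘ₗ LinearMap.snd _ _ _ ∘ₗ e₁'.symm.toLinearMap,
    K, X, L, rfl, rfl, rfl, e₁'.symm, e₂'.symm, fun v => by simp⟩

theorem exists_of_pseudoInverse {M N : FGProjModule R} (f : M.carrier →ₗ[Rᵐᵒᵖ] N.carrier)
    (g : N.carrier →ₗ[Rᵐᵒᵖ] M.carrier) (h : ∀ v, f (g (f v)) = f v) :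
    ∃ k x l, f.HasClass k x l := by
  obtain ⟨e₁, e₂, he⟩ := f.hasSplitType_of_pseudoInverse g h
  let i := e₁.symm.toLinearMap
  let s := e₁.toLinearMap
  let i' := e₂.symm.toLinearMap
  let s' := e₂.toLinearMap
  have : Module.Finite Rᵐᵒᵖ (LinearMap.ker f) :=
    .of_surjective (LinearMap.fst _ _ _ ∘ₗ s) (Prod.fst_surjective.comp e₁.surjective)
  have : Module.Finite Rᵐᵒᵖ (LinearMap.range f) :=
    .of_surjective (LinearMap.snd _ _ _ ∘ₗ s) (Prod.snd_surjective.comp e₁.surjective)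
  have : Module.Finite Rᵐᵒᵖ (LinearMap.ker (f ∘ₗ g)) :=
    .of_surjective (LinearMap.snd _ _ _ ∘ₗ s') (Prod.snd_surjective.comp e₂.surjective)
  have : Module.Projective Rᵐᵒᵖ (LinearMap.ker f) :=
    .of_split (i ∘ₗ LinearMap.inl _ _ _) (LinearMap.fst _ _ _ ∘ₗ s) (by ext v; simp [i, s])
  have : Module.Projective Rᵐᵒᵖ (LinearMap.range f) :=
    .of_split (i ∘ₗ LinearMap.inr _ _ _) (LinearMap.snd _ _ _ ∘ₗ s) (by ext v; simp [i, s])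
  have : Module.Projective Rᵐᵒᵖ (LinearMap.ker (f ∘ₗ g)) :=
    .of_split (i' ∘ₗ LinearMap.inr _ _ _) (LinearMap.snd _ _ _ ∘ₗ s') (by ext v; simp [i', s'])
  exact ⟨_, _, _, ⟨LinearMap.ker f⟩, ⟨LinearMap.range f⟩, ⟨LinearMap.ker (f ∘ₗ g)⟩, rfl, rfl, rfl,
    e₁, e₂, he⟩

end LinearMap.HasClass

/-! ### Matrices as maps of free right modules. -/

namespace Matrix

section ColMap

variable {R : Type*} [Ring R] {l m n : ℕ}

/-- The map of right modules `R ^ n → R ^ m` given by a matrix acting on columns. -/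
def colMap (A : Matrix (Fin m) (Fin n) R) : (Fin n → R) →ₗ[Rᵐᵒᵖ] (Fin m → R) where
  toFun v := A *ᵥ v
  map_add' := A.mulVec_add
  map_smul' r v := A.mulVec_smul r v

@[simp]
theorem colMap_apply (A : Matrix (Fin m) (Fin n) R) (v : Fin n → R) : A.colMap v = A *ᵥ v := rfl

theorem colMap_mul (A : Matrix (Fin l) (Fin m) R) (B : Matrix (Fin m) (Fin n) R) :
    (A * B).colMap = A.colMap ∘ₗ B.colMap := by
  refine LinearMap.ext fun v => ?_
  simp

theorem colMap_injective :
    Function.Injective (colMap : Matrix (Fin m) (Fin n) R → _) := by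
  intro A B h
  ext i j
  simpa using congrFun (LinearMap.congr_fun h (Pi.single j 1)) i

/-- The matrix of a map between free right modules. -/
def ofColMap (f : (Fin n → R) →ₗ[Rᵐᵒᵖ] (Fin m → R)) : Matrix (Fin m) (Fin n) R :=
  .of fun i j => f (Pi.single j 1) i

@[simp]
theorem colMap_ofColMap (f : (Fin n → R) →ₗ[Rᵐᵒᵖ] (Fin m → R)) : (ofColMap f).colMap = f := by
  refine LinearMap.pi_ext fun j x => ?_
  have : (Pi.single j x : Fin n → R) = MulOpposite.op x • Pi.single j (1 : R) := by
    rw [← Pi.single_smul]; simp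
  rw [this, map_smul, map_smul]
  congr 1
  ext i
  simp [ofColMap]

theorem isUnit_ofColMap (e : (Fin n → R) ≃ₗ[Rᵐᵒᵖ] (Fin n → R)) :
    IsUnit (ofColMap e.toLinearMap) := by
  refine ⟨⟨ofColMap e.toLinearMap, ofColMap e.symm.toLinearMap, ?_, ?_⟩, rfl⟩ <;>
  · apply colMap_injective
    rw [colMap_mul, colMap_ofColMap, colMap_ofColMap]
    refine LinearMap.ext fun v => ?_
    simp

/-- The automorphism of a free right module given by an invertible matrix. -/
def colEquiv (P : (Matrix (Fin n) (Fin n) R)ˣ) : (Fin n → R) ≃ₗ[Rᵐᵒᵖ] (Fin n → R) :=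
  .ofLinearMap P.1.colMap P.2.colMap (LinearMap.ext fun v => by rw [← colMap_mul]; simp)
    (LinearMap.ext fun v => by rw [← colMap_mul]; simp)

theorem IsRegularMatrix.of_colMap {A : Matrix (Fin m) (Fin n) R}
    (g : (Fin m → R) →ₗ[Rᵐᵒᵖ] (Fin n → R)) (h : ∀ v, A.colMap (g (A.colMap v)) = A.colMap v) :
    A.IsRegularMatrix := by
  refine ⟨ofColMap g, colMap_injective ?_⟩
  rw [colMap_mul, colMap_mul, colMap_ofColMap]
  refine LinearMap.ext fun v => ?_
  exact h v

/-- The block diagonal matrix with blocks a scalar `d` and a matrix `D`. -/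
def consDiagonal (d : R) (D : Matrix (Fin m) (Fin n) R) : Matrix (Fin (m + 1)) (Fin (n + 1)) R :=
  .of (Fin.cons (Fin.cons d 0) fun i => Fin.cons 0 (D i))

theorem colMap_consDiagonal (d : R) (D : Matrix (Fin m) (Fin n) R) (w : R × (Fin n → R)) :
    (consDiagonal d D).colMap (Fin.consLinearEquiv Rᵐᵒᵖ (fun _ : Fin (n + 1) => R) w) =
      Fin.consLinearEquiv Rᵐᵒᵖ (fun _ : Fin (m + 1) => R)
        ((LinearMap.mulLeft Rᵐᵒᵖ d).prodMap D.colMap w) := by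
  ext i
  refine Fin.cases ?_ (fun i => ?_) i
  · simp [consDiagonal, mulVec, dotProduct, Fin.sum_univ_succ, Fin.consLinearEquiv, Fin.consEquiv]
  · simp [consDiagonal, mulVec, dotProduct, Fin.sum_univ_succ, Fin.consLinearEquiv, Fin.consEquiv]

theorem IsDiagonalMatrix.consDiagonal {D : Matrix (Fin m) (Fin n) R} (hD : D.IsDiagonalMatrix)
    (d : R) : (consDiagonal d D).IsDiagonalMatrix := by
  intro i j
  refine Fin.cases ?_ (fun i => ?_) i <;> refine Fin.cases ?_ (fun j => ?_) j
  · simp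
  · simp [Matrix.consDiagonal]
  · simp [Matrix.consDiagonal]
  · intro h
    simpa [Matrix.consDiagonal] using hD i j (by simpa using h)

end ColMap

section HasClass

variable {R : Type u} [Ring R] {m n : ℕ} {k x l : ProjMonoid R}

theorem hasClass_consDiagonal {d : R} {D : Matrix (Fin m) (Fin n) R} {k₀ x₀ l₀ : ProjMonoid R}
    (hd : (LinearMap.mulLeft Rᵐᵒᵖ d).HasClass k₀ x₀ l₀) (hD : D.colMap.HasClass k x l) :
    (consDiagonal d D).colMap.HasClass (k₀ + k) (x₀ + x) (l₀ + l) := by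
  refine (hd.prodMap hD).of_equiv (Fin.consLinearEquiv Rᵐᵒᵖ fun _ : Fin (n + 1) => R).symm
    (Fin.consLinearEquiv Rᵐᵒᵖ fun _ : Fin (m + 1) => R) fun v => ?_
  rw [← colMap_consDiagonal, LinearEquiv.apply_symm_apply]

theorem hasClass_noRows (D : Matrix (Fin 0) (Fin n) R) :
    D.colMap.HasClass (n • ProjMonoid.mk (FGProjModule.self R)) 0 0 :=
  ⟨.pi R n, .zeroModule R, .zeroModule R, ProjMonoid.mk_pi n, rfl, rfl,
    (LinearEquiv.prodUnique : ((Fin n → R) × PUnit.{u + 1}) ≃ₗ[Rᵐᵒᵖ] _).symm,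
    (LinearEquiv.ofSubsingleton _ (PUnit.{u + 1} × PUnit.{u + 1}) :
      (Fin 0 → R) ≃ₗ[Rᵐᵒᵖ] _), fun _ => rfl⟩

theorem hasClass_noCols (D : Matrix (Fin m) (Fin 0) R) :
    D.colMap.HasClass 0 0 (m • ProjMonoid.mk (FGProjModule.self R)) :=
  ⟨.zeroModule R, .zeroModule R, .pi R m, rfl, rfl, ProjMonoid.mk_pi m,
    (LinearEquiv.ofSubsingleton _ (PUnit.{u + 1} × PUnit.{u + 1}) :
      (Fin 0 → R) ≃ₗ[Rᵐᵒᵖ] _),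
    (LinearEquiv.uniqueProd : (PUnit.{u + 1} × (Fin m → R)) ≃ₗ[Rᵐᵒᵖ] _).symm, fun v => by
      rw [Subsingleton.elim v 0, map_zero]; rfl⟩

/-- Each summand `(k₀, x₀, l₀)` is realized by an endomorphism of `R`, that is, by left
multiplication by a scalar. -/
theorem _root_.DiagonalType.exists_isDiagonalMatrix
    (h : DiagonalType (ProjMonoid.mk (FGProjModule.self R)) n m k x l) :
    ∃ D : Matrix (Fin m) (Fin n) R, D.IsDiagonalMatrix ∧ D.colMap.HasClass k x l := by
  induction h with
  | noRows n => exact ⟨0, fun _ _ _ => rfl, hasClass_noRows 0⟩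
  | noCols m => exact ⟨0, fun _ _ _ => rfl, hasClass_noCols 0⟩
  | cons hk hl _ ih =>
    obtain ⟨D, hD, hc⟩ := ih
    obtain ⟨f, hf⟩ := LinearMap.HasClass.exists_of_add_eq hk hl
    let f' : R →ₗ[Rᵐᵒᵖ] R := f
    have hf' : LinearMap.mulLeft Rᵐᵒᵖ (f' 1) = f' := by
      refine LinearMap.ext fun r => ?_
      simpa using (f'.map_smul (MulOpposite.op r) 1).symm
    exact ⟨_, hD.consDiagonal (f' 1), hasClass_consDiagonal (by rw [hf']; exact hf) hc⟩

theorem AdmitsDiagonalReduction.of_hasClass {A D : Matrix (Fin m) (Fin n) R}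
    (hA : A.colMap.HasClass k x l) (hD : D.IsDiagonalMatrix) (hc : D.colMap.HasClass k x l) :
    A.AdmitsDiagonalReduction := by
  obtain ⟨α, β, h⟩ := hA.exists_equiv hc
  refine ⟨_, _, isUnit_ofColMap β, isUnit_ofColMap α, ?_⟩
  convert hD
  apply colMap_injective
  rw [colMap_mul, colMap_mul, colMap_ofColMap, colMap_ofColMap]
  refine LinearMap.ext fun v => ?_
  exact h v

theorem hasClass_mul_mul {A : Matrix (Fin m) (Fin n) R} (hA : A.colMap.HasClass k x l)
    {P : Matrix (Fin m) (Fin m) R} {Q : Matrix (Fin n) (Fin n) R} (hP : IsUnit P) (hQ : IsUnit Q) :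
    (P * A * Q).colMap.HasClass k x l := by
  obtain ⟨P, rfl⟩ := hP
  obtain ⟨Q, rfl⟩ := hQ
  refine hA.of_equiv (colEquiv Q) (colEquiv P) fun v => ?_
  rw [colMap_mul, colMap_mul]
  rfl

theorem IsRegularMatrix.exists_hasClass {A : Matrix (Fin m) (Fin n) R} (hA : A.IsRegularMatrix) :
    ∃ k x l, A.colMap.HasClass k x l := by
  obtain ⟨B, hB⟩ := hA
  refine LinearMap.HasClass.exists_of_pseudoInverse (M := .pi R n) (N := .pi R m) A.colMap B.colMap
    fun v => ?_
  change (A.colMap ∘ₗ B.colMap ∘ₗ A.colMap) v = A.colMap v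
  rw [← LinearMap.comp_assoc, ← colMap_mul, ← colMap_mul, hB]

theorem isRegularMatrix_of_hasClass {A : Matrix (Fin m) (Fin n) R} (hA : A.colMap.HasClass k x l) :
    A.IsRegularMatrix := by
  obtain ⟨K, X, L, -, -, -, h⟩ := hA
  obtain ⟨g, hg⟩ := h.exists_pseudoInverse
  exact .of_colMap g hg

end HasClass

/-! ### Lifting modulo the Jacobson radical. -/

section Jacobson

theorem _root_.Ring.isUnit_of_sub_one_mem_jacobson {S : Type*} [Ring S] {r : S}
    (h : r - 1 ∈ (⊥ : Ideal S).jacobson) : IsUnit r := by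
  obtain ⟨s, hs⟩ := Ideal.exists_mul_sub_mem_of_sub_one_mem_jacobson r h
  rw [Ideal.mem_bot, sub_eq_zero] at hs
  -- The left inverse `s` is again congruent to `1`, so it has a left inverse too, which must be
  -- `r`.
  obtain ⟨t, ht⟩ := Ideal.exists_mul_sub_mem_of_sub_one_mem_jacobson (I := ⊥) s (by
    have : s - 1 = -(s * (r - 1)) := by rw [mul_sub, hs, mul_one, neg_sub]
    rw [this]
    exact neg_mem (Ideal.mul_mem_left _ _ h))
  rw [Ideal.mem_bot, sub_eq_zero] at ht
  have htr : t = r := left_inv_eq_right_inv ht hs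
  exact ⟨⟨r, s, htr ▸ ht, hs⟩, rfl⟩

variable {R : Type u} [Ring R] {m n : ℕ}

theorem isUnit_of_sub_one_mem_jacobson {A : Matrix (Fin n) (Fin n) R}
    (h : ∀ i j, (A - 1) i j ∈ Ring.jacobson R) : IsUnit A := by
  apply Ring.isUnit_of_sub_one_mem_jacobson
  have := Ideal.matrix_jacobson_le (n := Fin n) (⊥ : Ideal R)
  rw [Ideal.matrix_bot] at this
  apply this
  rw [Ideal.mem_matrix, Ideal.jacobson_bot]
  exact h

theorem isUnit_of_isUnit_map_quotient_jacobson {A : Matrix (Fin n) (Fin n) R}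
    (h : IsUnit (A.map (Ideal.Quotient.mk (Ring.jacobson R)))) : IsUnit A := by
  obtain ⟨u, hu⟩ := h
  have hsurj := Ideal.Quotient.mk_surjective (I := Ring.jacobson R)
  choose g hg using hsurj
  let B : Matrix (Fin n) (Fin n) R := u.2.map g
  have hB : B.map (Ideal.Quotient.mk (Ring.jacobson R)) = u.2 := by
    ext i j
    simp [B, hg]
  have key (C : Matrix (Fin n) (Fin n) R)
      (hC : C.map (Ideal.Quotient.mk (Ring.jacobson R)) = 1) : IsUnit C := by
    refine isUnit_of_sub_one_mem_jacobson fun i j => ?_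
    rw [← Ideal.Quotient.eq_zero_iff_mem]
    have := congrFun (congrFun hC i) j
    rw [map_apply] at this
    rw [sub_apply, map_sub, this, one_apply, one_apply]
    split_ifs <;> simp
  obtain ⟨v, hv⟩ := key (A * B) (by rw [Matrix.map_mul, hB, ← hu]; exact u.3)
  obtain ⟨w, hw⟩ := key (B * A) (by rw [Matrix.map_mul, hB, ← hu]; exact u.4)
  have h₁ : A * (B * v.2) = 1 := by rw [← mul_assoc, ← hv]; exact v.3
  have h₂ : (w.2 * B) * A = 1 := by rw [mul_assoc, ← hw]; exact w.4
  exact ⟨⟨A, B * v.2, h₁, left_inv_eq_right_inv h₂ h₁ ▸ h₂⟩, rfl⟩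

theorem exists_isUnit_map_eq {P : Matrix (Fin n) (Fin n) (R ⧸ Ring.jacobson R)} (hP : IsUnit P) :
    ∃ P' : Matrix (Fin n) (Fin n) R,
      IsUnit P' ∧ P'.map (Ideal.Quotient.mk (Ring.jacobson R)) = P := by
  choose g hg using Ideal.Quotient.mk_surjective (I := Ring.jacobson R)
  have h : (P.map g).map (Ideal.Quotient.mk (Ring.jacobson R)) = P := by
    ext i j
    simp [hg]
  exact ⟨P.map g, isUnit_of_isUnit_map_quotient_jacobson (by rwa [h]), h⟩

/-- Diagonal reductions of regular rows lift modulo the Jacobson radical. -/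
theorem AdmitsDiagonalReduction.of_quotient_jacobson_row
    (h : RegularMatricesDiagonalizable (R ⧸ Ring.jacobson R)) {A : Matrix (Fin 1) (Fin n) R}
    (hA : A.IsRegularMatrix) : A.AdmitsDiagonalReduction := by
  obtain ⟨B, hB⟩ := id hA
  obtain ⟨P, Q, hP, hQ, hD⟩ := h 1 n (A.map (Ideal.Quotient.mk (Ring.jacobson R)))
    ⟨B.map (Ideal.Quotient.mk (Ring.jacobson R)), by rw [← Matrix.map_mul, ← Matrix.map_mul, hB]⟩
  obtain ⟨P, hP₀, rfl⟩ := exists_isUnit_map_eq hP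
  obtain ⟨Q, hQ₀, rfl⟩ := exists_isUnit_map_eq hQ
  rw [← Matrix.map_mul, ← Matrix.map_mul] at hD
  obtain ⟨k, x, l, hc⟩ := hA.exists_hasClass
  obtain ⟨Y, hY⟩ := isRegularMatrix_of_hasClass (hasClass_mul_mul hc hP₀ hQ₀)
  set X := P * A * Q with hX
  -- Right multiplication by `E` keeps exactly the off-diagonal entries of a row.
  let E : Matrix (Fin n) (Fin n) R := diagonal fun j => if (j : ℕ) = 0 then 0 else 1
  have hXE (j : Fin n) : (X * E) 0 j ∈ Ring.jacobson R := by
    rw [mul_diagonal]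
    split_ifs with hj
    · simp
    · rw [mul_one, ← Ideal.Quotient.eq_zero_iff_mem]
      exact hD 0 j (by simpa using Ne.symm hj)
  have hU : IsUnit (1 - Y * (X * E)) := by
    refine isUnit_of_sub_one_mem_jacobson fun i j => ?_
    rw [sub_sub_cancel_left, neg_apply, mul_apply]
    refine neg_mem (sum_mem fun t _ => Ideal.mul_mem_left _ _ ?_)
    rw [Subsingleton.elim t 0]
    exact hXE j
  refine ⟨P, Q * (1 - Y * (X * E)), hP₀, hQ₀.mul hU, ?_⟩
  -- Regularity `X * Y * X = X` makes the column operation subtract exactly the off-diagonal part.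
  have : P * A * (Q * (1 - Y * (X * E))) = X - X * E := by
    rw [← Matrix.mul_assoc, ← hX, Matrix.mul_sub, Matrix.mul_one, ← Matrix.mul_assoc,
      ← Matrix.mul_assoc, hY]
  rw [this]
  intro i j hij
  rw [Subsingleton.elim i 0] at hij ⊢
  have hj : (j : ℕ) ≠ 0 := by simpa using Ne.symm hij
  rw [sub_apply, mul_diagonal, if_neg hj, mul_one, sub_self]

end Jacobson

end Matrix

namespace ProjMonoid

open Matrix

/-- The two equations make `(a, c, b)` the class of a regular `1 × 2` row. Its diagonal form `(d,
0)` has kernel `k + e` and image `c`, where `c + k = e`. Hence `a = k + e = k + c + b = e + b`. -/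
theorem cancel_of_quotient_jacobson {R : Type u} [Ring R]
    (h : RegularMatricesDiagonalizable (R ⧸ Ring.jacobson R)) (a b c : ProjMonoid R)
    (hb : c + b = mk (FGProjModule.self R))
    (ha : c + a = mk (FGProjModule.self R) + mk (FGProjModule.self R)) :
    a = mk (FGProjModule.self R) + b := by
  obtain ⟨f, hf⟩ := LinearMap.HasClass.exists_of_add_eq (M := .pi R 2) (N := .pi R 1)
    (ha.trans (by rw [mk_pi, two_nsmul])) (hb.trans (by rw [mk_pi, one_nsmul]))
  let f' : (Fin 2 → R) →ₗ[Rᵐᵒᵖ] (Fin 1 → R) := f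
  have hA : (ofColMap f').colMap.HasClass a c b := by rw [colMap_ofColMap]; exact hf
  obtain ⟨P, Q, hP, hQ, hD⟩ :=
    AdmitsDiagonalReduction.of_quotient_jacobson_row h (isRegularMatrix_of_hasClass hA)
  have hPQ := hasClass_mul_mul hA hP hQ
  set D := P * ofColMap f' * Q
  obtain ⟨Y, hY⟩ := isRegularMatrix_of_hasClass hPQ
  have hDd : D = consDiagonal (D 0 0) 0 := by
    ext i j
    rw [Subsingleton.elim i 0]
    refine Fin.cases ?_ (fun j => ?_) j
    · simp [consDiagonal]
    · simpa [consDiagonal] using hD 0 j.succ (by simp)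
  have hd : D 0 0 * Y 0 0 * D 0 0 = D 0 0 := by
    have h₁ : D 0 1 = 0 := hD 0 1 (by simp)
    have := congrFun (congrFun hY 0) 0
    simpa [mul_apply, Fin.sum_univ_succ, h₁] using this
  obtain ⟨k, x, l, hkxl⟩ := LinearMap.HasClass.exists_of_pseudoInverse
    (M := .self R) (N := .self R) (LinearMap.mulLeft Rᵐᵒᵖ (D 0 0) : R →ₗ[Rᵐᵒᵖ] R)
    (LinearMap.mulLeft Rᵐᵒᵖ (Y 0 0) : R →ₗ[Rᵐᵒᵖ] R) (fun v : R => by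
      change D 0 0 * (Y 0 0 * (D 0 0 * v)) = D 0 0 * v
      rw [← mul_assoc, ← mul_assoc, hd])
  -- The row `(d, 0)` is the block sum of `d` and an empty `0 × 1` matrix, whose kernel is `R`.
  have hc := hasClass_consDiagonal hkxl (hasClass_noRows (0 : Matrix (Fin 0) (Fin 1) R))
  rw [← hDd] at hc
  have hx : c = x := by simpa using hPQ.range_unique hc
  have hk : a = k + mk (FGProjModule.self R) := by simpa using hPQ.ker_unique hc
  have hxk : x + k = mk (FGProjModule.self R) := hkxl.add_eq_domain (M := .self R) (N := .self R)
  rw [hk]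
  nth_rw 1 [← hb]
  rw [← hxk, hx]
  abel

end ProjMonoid

theorem proposition3p6 (R : Type u) [Ring R] (hR : IsRefinementRing R)
    (h : RegularMatricesDiagonalizable (R ⧸ Ring.jacobson R)) :
    RegularMatricesDiagonalizable R := by
  intro m n A hA
  obtain _ | m := m
  · exact ⟨1, 1, isUnit_one, isUnit_one, fun i => i.elim0⟩
  obtain _ | n := n
  · exact ⟨1, 1, isUnit_one, isUnit_one, fun _ j => j.elim0⟩
  obtain ⟨k, x, l, hc⟩ := hA.exists_hasClass
  have hk := hc.add_eq_domain (M := .pi R (n + 1)) (N := .pi R (m + 1))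
  have hl := hc.add_eq_codomain (M := .pi R (n + 1)) (N := .pi R (m + 1))
  rw [ProjMonoid.mk_pi] at hk hl
  obtain ⟨D, hD, hDc⟩ := (HasRefinementProperty.diagonalType hR
    (ProjMonoid.cancel_of_quotient_jacobson h) hk hl).exists_isDiagonalMatrix
  exact .of_hasClass hc hD hDc
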